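/- Rings are associative and need not have an identity. A derivation of a ring $A$ is an additive map $d:A\to A$ with $d(ab)=d(a)b+a\,d(b)$, and $A[X;d]$ denotes the differential polynomial ring, whose elements are the polynomials $\sum_k a_kX^k$ with coefficients in $A$ and whose multiplication is determined by $Xa=aX+d(a)$ for $a\in A$. A ring is locally nilpotent if each of its finitely generated subrings is nilpotent. A ring is Behrens radical if it cannot be mapped homomorphically onto a ring with a nonzero idempotent. Theorem 4. Let $R$ be a locally nilpotent ring, and let $R[X_1;d_1]\dots[X_n;d_n]$ be an iterated differential polynomial ring over $R$, that is, for each $1\le i\le n$, $d_i$ is a derivation of $R[X_1;d_1]\dots[X_{i-1};d_{i-1}]$. Let $R^*=\mathbb{Z}\oplus R$ be the ring obtained from $R$ by adjoining an identity element. Suppose that $d_1,\dots,d_n$ can be successively extended, so that for each $i$ the map $d_i$ extends to a derivation, again denoted $d_i$, of $R^*[X_1;d_1]\dots[X_{i-1};d_{i-1}]$, such that $d_i(R)\subseteq R$ and $d_i(X_j)\in R^*$ for all $1\le j<i$. Then $R[X_1;d_1]\dots[X_n;d_n]$ is Behrens radical. -/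

import Mathlib

universe u

/-- An associative ring, not necessarily with identity, is *nilpotent* if for some `n` all products
`a * x₁ * ⋯ * xₙ` of `n + 1` of its elements vanish. -/
def IsNilpotentRing (S : Type u) [NonUnitalRing S] : Prop :=
  ∃ n : ℕ, ∀ (a : S) (l : List S), l.length = n → l.foldl (fun x y => x * y) a = 0

/-- A ring is *locally nilpotent* if each of its finitely generated subrings is nilpotent. -/
def IsLocallyNilpotentRing (R : Type u) [NonUnitalRing R] : Prop :=
  ∀ s : Finset R, IsNilpotentRing (NonUnitalSubring.closure (s : Set R))

/-- A ring is *Behrens radical* if it cannot be mapped onto a ring with a nonzero idempotent. -/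
def IsBehrensRadical (S : Type u) [NonUnitalRing S] : Prop :=
  ∀ (B : Type u) [NonUnitalRing B] (f : S →ₙ+* B), Function.Surjective f →
    ∀ e : B, IsIdempotentElem e → e = 0

/-- A derivation of a (not necessarily commutative or unital) ring: an additive map satisfying the
Leibniz rule. -/
structure RingDerivation (A : Type u) [NonUnitalRing A] extends A →+ A where
  leibniz : ∀ a b : A, toFun (a * b) = toFun a * b + a * toFun b

instance (A : Type u) [NonUnitalRing A] : CoeFun (RingDerivation A) (fun _ => A → A) :=
  ⟨fun d => d.toAddMonoidHom⟩

/-- The differential polynomial ring `A[X;d]`: its elements are the polynomials `∑ aₖ Xᵏ`,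
represented by their finitely supported coefficient sequences. -/
def DiffPoly {A : Type u} [NonUnitalRing A] (_d : RingDerivation A) : Type u := ℕ →₀ A

namespace DiffPoly

noncomputable section

variable {A : Type u} [NonUnitalRing A] {d : RingDerivation A}

instance : AddCommGroup (DiffPoly d) := inferInstanceAs (AddCommGroup (ℕ →₀ A))

/-- `a ↦ a Xᵏ` -/
def monomial (d : RingDerivation A) (k : ℕ) : A →+ DiffPoly d := Finsupp.singleAddHom k

/-- Left multiplication by `X`. As `X a = a X + d a`, it maps `a Xᵏ` to `a Xᵏ⁺¹ + (d a) Xᵏ`. -/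
def mulX (d : RingDerivation A) : DiffPoly d →+ DiffPoly d :=
  Finsupp.liftAddHom fun k => monomial d (k + 1) + (monomial d k).comp d.toAddMonoidHom

/-- Left multiplication by `Xᵏ`. -/
def mulXPow (d : RingDerivation A) : ℕ → (DiffPoly d →+ DiffPoly d)
  | 0 => AddMonoidHom.id _
  | k + 1 => (mulX d).comp (mulXPow d k)

/-- Left multiplication by a constant `a`: it maps `b Xᵏ` to `(a b) Xᵏ`. -/
def mulConst (d : RingDerivation A) : A →+ (DiffPoly d →+ DiffPoly d) :=
  AddMonoidHom.flip
    (Finsupp.liftAddHom fun k => (AddMonoidHom.compHom (monomial d k)).comp AddMonoidHom.mul.flip)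

/-- Multiplication: `(∑ aₖ Xᵏ) q = ∑ aₖ (X (X ⋯ (X q)))`, with `k` factors `X`. -/
def mulHom (d : RingDerivation A) : DiffPoly d →+ (DiffPoly d →+ DiffPoly d) :=
  Finsupp.liftAddHom fun k => (AddMonoidHom.compHom.flip (mulXPow d k)).comp (mulConst d)

instance : Mul (DiffPoly d) := ⟨fun p q => mulHom d p q⟩

theorem mul_def (p q : DiffPoly d) : p * q = mulHom d p q := rfl

theorem addHom_ext {M : Type*} [AddZeroClass M] {f g : DiffPoly d →+ M}
    (h : ∀ k a, f (monomial d k a) = g (monomial d k a)) : f = g :=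
  Finsupp.addHom_ext h

theorem mulX_monomial (k : ℕ) (a : A) :
    mulX d (monomial d k a) = monomial d (k + 1) a + monomial d k (d a) :=
  Finsupp.liftAddHom_apply_single _ _ _

theorem mulConst_monomial (a : A) (k : ℕ) (b : A) :
    mulConst d a (monomial d k b) = monomial d k (a * b) :=
  DFunLike.congr_fun (Finsupp.liftAddHom_apply_single
    (fun k => (AddMonoidHom.compHom (monomial d k)).comp AddMonoidHom.mul.flip) k b) a

theorem monomial_mul (k : ℕ) (a : A) (q : DiffPoly d) :
    monomial d k a * q = mulConst d a (mulXPow d k q) :=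
  DFunLike.congr_fun (Finsupp.liftAddHom_apply_single
    (fun k => (AddMonoidHom.compHom.flip (mulXPow d k)).comp (mulConst d)) k a) q

theorem mulConst_mulConst (a b : A) (q : DiffPoly d) :
    mulConst d a (mulConst d b q) = mulConst d (a * b) q := by
  refine DFunLike.congr_fun (f := (mulConst d a).comp (mulConst d b)) (addHom_ext fun k c => ?_) q
  simp [mulConst_monomial, mul_assoc]

theorem mulX_mulConst (a : A) (q : DiffPoly d) :
    mulX d (mulConst d a q) = mulConst d a (mulX d q) + mulConst d (d a) q := by
  refine DFunLike.congr_fun (f := (mulX d).comp (mulConst d a))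
    (g := (mulConst d a).comp (mulX d) + mulConst d (d a)) (addHom_ext fun k c => ?_) q
  have := d.leibniz a c
  simp only [AddMonoidHom.comp_apply, AddMonoidHom.add_apply, mulConst_monomial, mulX_monomial,
    map_add]
  rw [show d (a * c) = d a * c + a * d c from this, map_add]
  abel

instance : NonUnitalNonAssocRing (DiffPoly d) where
  left_distrib p q r := map_add (mulHom d p) q r
  right_distrib p q r := DFunLike.congr_fun (map_add (mulHom d) p q) r
  zero_mul p := DFunLike.congr_fun (map_zero (mulHom d)) p
  mul_zero p := map_zero (mulHom d p)

theorem mulConst_mul (a : A) (p q : DiffPoly d) :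
    mulConst d a p * q = mulConst d a (p * q) := by
  refine DFunLike.congr_fun (f := (AddMonoidHom.mulRight q).comp (mulConst d a))
    (g := (mulConst d a).comp (AddMonoidHom.mulRight q)) (addHom_ext fun k c => ?_) p
  simp [mulConst_monomial, monomial_mul, mulConst_mulConst]

theorem mulX_mul (p q : DiffPoly d) : mulX d p * q = mulX d (p * q) := by
  refine DFunLike.congr_fun (f := (AddMonoidHom.mulRight q).comp (mulX d))
    (g := (mulX d).comp (AddMonoidHom.mulRight q)) (addHom_ext fun k c => ?_) p
  simp [mulX_monomial, monomial_mul, mulX_mulConst, add_mul, mulXPow]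

theorem mulXPow_mul (k : ℕ) (p q : DiffPoly d) :
    mulXPow d k p * q = mulXPow d k (p * q) := by
  induction k with
  | zero => rfl
  | succ k ih => simp [mulXPow, mulX_mul, ih]

instance : NonUnitalRing (DiffPoly d) where
  mul_assoc p q r := by
    refine DFunLike.congr_fun
      (f := (AddMonoidHom.mulRight r).comp (AddMonoidHom.mulRight q))
      (g := AddMonoidHom.mulRight (q * r)) (addHom_ext fun k c => ?_) p
    simp [monomial_mul, mulConst_mul, mulXPow_mul]

end

end DiffPoly

/-- A bundled associative ring, not necessarily with identity. -/
structure BundledRing : Type (u + 1) where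
  carrier : Type u
  [ring : NonUnitalRing carrier]

/-- By recursion on `n`: the type of all sequences `(d₁, …, dₙ)` in which `dᵢ` is a derivation of
`R[X₁;d₁]⋯[Xᵢ₋₁;dᵢ₋₁]`, and, for each such sequence, the ring `R[X₁;d₁]⋯[Xₙ;dₙ]`. -/
noncomputable def iteratedData (R : Type u) [NonUnitalRing R] : ℕ → (T : Type u) × (T → BundledRing.{u})
  | 0 => ⟨PUnit, fun _ => ⟨R⟩⟩
  | n + 1 =>
    ⟨(d : (iteratedData R n).1) ×
        @RingDerivation ((iteratedData R n).2 d).carrier ((iteratedData R n).2 d).ring,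
      fun d => ⟨@DiffPoly _ ((iteratedData R n).2 d.1).ring d.2⟩⟩

/-- The sequences `(d₁, …, dₙ)` in which `dᵢ` is a derivation of `R[X₁;d₁]⋯[Xᵢ₋₁;dᵢ₋₁]`.
For `d : DerivationSeq R (n + 1)`, `d.1 : DerivationSeq R n` is the sequence of its first `n` terms
and `d.2` is its last term. -/
def DerivationSeq (R : Type u) [NonUnitalRing R] (n : ℕ) : Type u := (iteratedData R n).1

/-- The iterated differential polynomial ring `R[X₁;d₁]⋯[Xₙ;dₙ]`. -/
def IteratedDiffPoly {R : Type u} [NonUnitalRing R] {n : ℕ} (d : DerivationSeq R n) : Type u :=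
  ((iteratedData R n).2 d).carrier

noncomputable instance {R : Type u} [NonUnitalRing R] {n : ℕ} (d : DerivationSeq R n) :
    NonUnitalRing (IteratedDiffPoly d) :=
  ((iteratedData R n).2 d).ring

namespace DerivationSeq

noncomputable section

/-- The first `n` derivations of a sequence of `n + 1`. -/
def init {R : Type u} [NonUnitalRing R] {n : ℕ} (d : DerivationSeq R (n + 1)) :
    DerivationSeq R n := d.1

/-- The last derivation of a sequence of `n + 1`, a derivation of the ring built from the others. -/
def last {R : Type u} [NonUnitalRing R] {n : ℕ} (d : DerivationSeq R (n + 1)) :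
    RingDerivation (IteratedDiffPoly d.init) := d.2

/-- `a Xᵏ` for `a` in `R[X₁;d₁]⋯[Xₙ;dₙ]`, where `X` is the variable `Xₙ₊₁`. -/
def monomial {R : Type u} [NonUnitalRing R] {n : ℕ} (d : DerivationSeq R (n + 1)) (k : ℕ) :
    IteratedDiffPoly d.init →+ IteratedDiffPoly d :=
  DiffPoly.monomial d.last k

/-- The inclusion of the elements of `R` as constants in `R[X₁;d₁]⋯[Xₙ;dₙ]`. -/
def const {R : Type u} [NonUnitalRing R] : {n : ℕ} → (d : DerivationSeq R n) →
    R →+ IteratedDiffPoly d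
  | 0, _ => AddMonoidHom.id R
  | _ + 1, d => (d.monomial 0).comp d.init.const

/-- The variable `Xⱼ₊₁` (`0 ≤ j < n`) of `R[X₁;d₁]⋯[Xₙ;dₙ]`, for a ring `R` with identity. -/
def var {R : Type u} [Ring R] : {n : ℕ} → (d : DerivationSeq R n) → Fin n →
    IteratedDiffPoly d
  | 0, _ => Fin.elim0
  | _ + 1, d => Fin.lastCases (d.monomial 1 (d.init.const 1)) fun j => d.monomial 0 (d.init.var j)

variable {R : Type u} [NonUnitalRing R]

/-- The inclusion of `R` into `R* = ℤ ⊕ R`, the ring `R` with an identity adjoined. -/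
def toUnitization (R : Type u) [NonUnitalRing R] : R →+ Unitization ℤ R where
  toFun r := (r : Unitization ℤ R)
  map_zero' := Unitization.inr_zero ℤ
  map_add' := Unitization.inr_add ℤ

/-- The inclusion of `R[X₁;d₁]⋯[Xₙ;dₙ]` into `R*[X₁;D₁]⋯[Xₙ;Dₙ]`, coefficient by coefficient. -/
def incl : {n : ℕ} → (d : DerivationSeq R n) → (D : DerivationSeq (Unitization ℤ R) n) →
    IteratedDiffPoly d →+ IteratedDiffPoly D
  | 0, _, _ => toUnitization R
  | _ + 1, d, D =>
    Finsupp.liftAddHom fun k => (D.monomial k).comp (incl d.init D.init)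

/-- Each `Dᵢ` extends `dᵢ` from `R[X₁;d₁]⋯[Xᵢ₋₁;dᵢ₋₁]` to `R*[X₁;D₁]⋯[Xᵢ₋₁;Dᵢ₋₁]`. -/
def Extends : {n : ℕ} → DerivationSeq (Unitization ℤ R) n → DerivationSeq R n → Prop
  | 0, _, _ => True
  | _ + 1, D, d =>
    Extends D.init d.init ∧
      ∀ p, D.last (incl d.init D.init p) = incl d.init D.init (d.last p)

/-- Each `Dᵢ` maps `R` into `R`. -/
def PreservesBase : {n : ℕ} → DerivationSeq (Unitization ℤ R) n → Prop
  | 0, _ => True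
  | _ + 1, D =>
    PreservesBase D.init ∧
      ∀ r : R, ∃ r' : R, D.last (D.init.const (r : Unitization ℤ R)) =
        D.init.const (r' : Unitization ℤ R)

/-- `Dᵢ(Xⱼ)` is a constant, i.e. lies in `R*`, for all `j < i`. -/
def MapsVarsToConst : {n : ℕ} → DerivationSeq (Unitization ℤ R) n → Prop
  | 0, _ => True
  | n + 1, D =>
    MapsVarsToConst D.init ∧
      ∀ j : Fin n, ∃ s : Unitization ℤ R, D.last (D.init.var j) = D.init.const s

end

end DerivationSeq

/-! The differential polynomial ring is an ideal in the corresponding ring over `R*`, which has an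
identity. An idempotent in an image of the ideal therefore gives an idempotent `e` in a quotient of
the larger ring, where it suffices to prove `e = 0`. There the images `x i` of the variables satisfy
`[x i, R] ⊆ R` and `[x i, x j] ∈ ℤ + R`, and `e` is a sum of words of length at most `n` with
coefficients from `R` on the left.

Two facts combine. Commutators with the `x i` do not raise the degree (`comm_mem_wordSpan_range`),
so the finitely many iterated commutators of `e` of length at most `n` use coefficients from one
finite set `C` and words of length at most `n`. Conversely, since `e * e = e`, every word `w` of
length at most `n` has `w * e` in the right ideal generated by the products `D * e`, with `D` such a
commutator (`word_mul_mem_closure_iteratedComm`). Hence `w * e` is a sum of terms `c * w' * e * b`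
with `c ∈ C` and `w'` under the same length bound. Iterating puts arbitrarily long products from `C`
in front, and these vanish by local nilpotence. The empty word gives `e = 0`. -/

/-! ### Spans of words with coefficients on the left. -/

section Words

variable {B ι : Type*} [Ring B]

/-- The additive span of the products `c * w` with `c` in a set `C` and `w` a word of length at most
`k` in the elements `x i`. -/
def wordSpan (x : ι → B) (C : Set B) (k : ℕ) : AddSubgroup B :=
  AddSubgroup.closure {y | ∃ c ∈ C, ∃ l : List ι, l.length ≤ k ∧ y = c * (l.map x).prod}

/-- The iterated commutator `[x i₁, [x i₂, ⋯ [x iₖ, e]]]`. -/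
def iteratedComm (x : ι → B) (l : List ι) (e : B) : B :=
  l.foldr (fun i y => x i * y - y * x i) e

/-- The additive span of the products `w * e * b` with `w` a word of length less than `k` in the
elements `x i`. -/
def shorterWordSpan (x : ι → B) (e : B) (k : ℕ) : AddSubgroup B :=
  AddSubgroup.closure {y | ∃ l : List ι, l.length < k ∧ ∃ b, y = (l.map x).prod * e * b}

theorem AddSubgroup.map_mem_of_closure {M N : Type*} [AddGroup M] [AddGroup N] {s : Set M}
    (f : M →+ N) (H : AddSubgroup N) (h : ∀ y ∈ s, f y ∈ H) {y : M}
    (hy : y ∈ AddSubgroup.closure s) : f y ∈ H :=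
  (AddSubgroup.closure_le (H.comap f)).2 h hy

theorem mem_wordSpan {x : ι → B} {C : Set B} {k : ℕ} {c : B} (hc : c ∈ C) {l : List ι}
    (hl : l.length ≤ k) : c * (l.map x).prod ∈ wordSpan x C k :=
  AddSubgroup.subset_closure ⟨c, hc, l, hl, rfl⟩

theorem wordSpan_mono {x : ι → B} {C C' : Set B} {k k' : ℕ} (hC : C ⊆ C') (hk : k ≤ k') :
    wordSpan x C k ≤ wordSpan x C' k' :=
  AddSubgroup.closure_mono fun _ ⟨c, hc, l, hl, h⟩ => ⟨c, hC hc, l, hl.trans hk, h⟩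

theorem exists_wordSpan_of_mem_closure {x : ι → B} {C : Set B} {e : B}
    (he : e ∈ AddSubgroup.closure {y | ∃ c ∈ C, ∃ l : List ι, y = c * (l.map x).prod}) :
    ∃ k, e ∈ wordSpan x C k := by
  induction he using AddSubgroup.closure_induction with
  | mem y hy =>
    obtain ⟨c, hc, l, rfl⟩ := hy
    exact ⟨l.length, mem_wordSpan hc le_rfl⟩
  | zero => exact ⟨0, zero_mem _⟩
  | add y z _ _ hy hz =>
    obtain ⟨k, hk⟩ := hy
    obtain ⟨m, hm⟩ := hz
    exact ⟨max k m, add_mem (wordSpan_mono subset_rfl (le_max_left _ _) hk)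
      (wordSpan_mono subset_rfl (le_max_right _ _) hm)⟩
  | neg y _ hy =>
    obtain ⟨k, hk⟩ := hy
    exact ⟨k, neg_mem hk⟩

/-- Only finitely many coefficients occur in one element; local nilpotence applies to finite sets
only. -/
theorem exists_finset_wordSpan {R : Type*} (ρ : R → B) {x : ι → B} {k : ℕ} {y : B}
    (hy : y ∈ wordSpan x (Set.range ρ) k) :
    ∃ C : Finset R, y ∈ wordSpan x (ρ '' C) k := by
  classical
  induction hy using AddSubgroup.closure_induction with
  | mem y hy =>
    obtain ⟨_, ⟨r, rfl⟩, l, hl, rfl⟩ := hy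
    exact ⟨{r}, mem_wordSpan (by simp) hl⟩
  | zero => exact ⟨∅, zero_mem _⟩
  | add y z _ _ hy hz =>
    obtain ⟨C, hC⟩ := hy
    obtain ⟨C', hC'⟩ := hz
    exact ⟨C ∪ C', add_mem (wordSpan_mono (Set.image_mono (by simp)) le_rfl hC)
      (wordSpan_mono (Set.image_mono (by simp)) le_rfl hC')⟩
  | neg y _ hy =>
    obtain ⟨C, hC⟩ := hy
    exact ⟨C, neg_mem hC⟩

/-! ### Commutators with the variables preserve degree. -/

section Normalizing

variable {R : Type*} [NonUnitalRing R] {ρ : R →ₙ+* B} {x : ι → B}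

theorem mul_mem_wordSpan_range (h₁ : ∀ i r, ∃ r', x i * ρ r - ρ r * x i = ρ r') (i : ι) {k : ℕ}
    {y : B} (hy : y ∈ wordSpan x (Set.range ρ) k) :
    x i * y ∈ wordSpan x (Set.range ρ) (k + 1) := by
  refine AddSubgroup.map_mem_of_closure (AddMonoidHom.mulLeft (x i)) _ ?_ hy
  rintro _ ⟨_, ⟨r, rfl⟩, l, hl, rfl⟩
  obtain ⟨r', hr'⟩ := h₁ i r
  have : x i * (ρ r * (l.map x).prod) =
      ρ r * ((i :: l).map x).prod + ρ r' * (l.map x).prod := by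
    rw [← hr', List.map_cons, List.prod_cons]; noncomm_ring
  rw [AddMonoidHom.coe_mulLeft, this]
  exact add_mem (mem_wordSpan (Set.mem_range_self r) (by simpa))
    (mem_wordSpan (Set.mem_range_self r') (by omega))

/-- `R` is an ideal of `ℤ + R`, so a factor from `R` on the left absorbs integer coefficients. -/
theorem const_mul_mem_wordSpan_range {r : R} {k : ℕ} {y : B}
    (hy : y ∈ wordSpan x (Set.range ρ ∪ {1}) k) : ρ r * y ∈ wordSpan x (Set.range ρ) k := by
  refine AddSubgroup.map_mem_of_closure (AddMonoidHom.mulLeft (ρ r)) _ ?_ hy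
  rintro _ ⟨_, ⟨s, rfl⟩ | rfl, l, hl, rfl⟩
  · rw [AddMonoidHom.coe_mulLeft, ← mul_assoc, ← map_mul]
    exact mem_wordSpan (Set.mem_range_self _) hl
  · rw [AddMonoidHom.coe_mulLeft, one_mul]
    exact mem_wordSpan (Set.mem_range_self _) hl

theorem mul_mem_wordSpan_range_union_one (h₁ : ∀ i r, ∃ r', x i * ρ r - ρ r * x i = ρ r') (i : ι)
    {k : ℕ} {y : B} (hy : y ∈ wordSpan x (Set.range ρ ∪ {1}) k) :
    x i * y ∈ wordSpan x (Set.range ρ ∪ {1}) (k + 1) := by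
  refine AddSubgroup.map_mem_of_closure (AddMonoidHom.mulLeft (x i)) _ ?_ hy
  rintro _ ⟨_, hs | rfl, l, hl, rfl⟩
  · exact wordSpan_mono Set.subset_union_left le_rfl
      (mul_mem_wordSpan_range h₁ i (mem_wordSpan hs hl))
  · have : x i * (1 * (l.map x).prod) = 1 * ((i :: l).map x).prod := by simp
    rw [AddMonoidHom.coe_mulLeft, this]
    exact mem_wordSpan (by simp) (by simpa)

/-- Moving `x i` past one letter costs a constant from `ℤ + R`, which replaces both letters. By `h₁`
this constant can then be carried to the left without lengthening the word. The integer part is why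
`1` must be admitted as a coefficient. -/
theorem comm_word_mem (h₁ : ∀ i r, ∃ r', x i * ρ r - ρ r * x i = ρ r')
    (h₂ : ∀ i j, ∃ (m : ℤ) (r : R), x i * x j - x j * x i = m + ρ r) (i : ι) (l : List ι) :
    x i * (l.map x).prod - (l.map x).prod * x i ∈
      wordSpan x (Set.range ρ ∪ {1}) l.length := by
  induction l with
  | nil => simp
  | cons j l ih =>
    obtain ⟨m, r, h⟩ := h₂ i j
    have : x i * ((j :: l).map x).prod - ((j :: l).map x).prod * x i =
        m • (1 * (l.map x).prod) + ρ r * (l.map x).prod +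
          x j * (x i * (l.map x).prod - (l.map x).prod * x i) := by
      have h' : x i * x j = m + ρ r + x j * x i := by rw [← h]; abel
      rw [List.map_cons, List.prod_cons, ← mul_assoc, h', zsmul_eq_mul]
      noncomm_ring
    rw [this]
    refine add_mem (add_mem (zsmul_mem (mem_wordSpan (by simp) (by simp)) _)
      (mem_wordSpan (by simp) (by simp))) (mul_mem_wordSpan_range_union_one h₁ j ih)

/-- By the Leibniz rule the commutator falls either on the coefficient, giving another element of
`R`, or on the word. In the second case the coefficient still standing in front absorbs the
integers. -/
theorem comm_mem_wordSpan_range (h₁ : ∀ i r, ∃ r', x i * ρ r - ρ r * x i = ρ r')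
    (h₂ : ∀ i j, ∃ (m : ℤ) (r : R), x i * x j - x j * x i = m + ρ r) (i : ι) {k : ℕ} {y : B}
    (hy : y ∈ wordSpan x (Set.range ρ) k) :
    x i * y - y * x i ∈ wordSpan x (Set.range ρ) k := by
  refine AddSubgroup.map_mem_of_closure
    (AddMonoidHom.mulLeft (x i) - AddMonoidHom.mulRight (x i)) _ ?_ hy
  rintro _ ⟨_, ⟨r, rfl⟩, l, hl, rfl⟩
  obtain ⟨r', hr'⟩ := h₁ i r
  have : x i * (ρ r * (l.map x).prod) - ρ r * (l.map x).prod * x i =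
      ρ r' * (l.map x).prod + ρ r * (x i * (l.map x).prod - (l.map x).prod * x i) := by
    rw [← hr']; noncomm_ring
  rw [AddMonoidHom.sub_apply, AddMonoidHom.coe_mulLeft, AddMonoidHom.mulRight_apply, this]
  exact add_mem (mem_wordSpan (Set.mem_range_self _) hl) (const_mul_mem_wordSpan_range
    (wordSpan_mono subset_rfl hl (comm_word_mem h₁ h₂ i l)))

theorem iteratedComm_mem_wordSpan_range (h₁ : ∀ i r, ∃ r', x i * ρ r - ρ r * x i = ρ r')
    (h₂ : ∀ i j, ∃ (m : ℤ) (r : R), x i * x j - x j * x i = m + ρ r) {k : ℕ} {e : B}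
    (he : e ∈ wordSpan x (Set.range ρ) k) (l : List ι) :
    iteratedComm x l e ∈ wordSpan x (Set.range ρ) k := by
  induction l with
  | nil => exact he
  | cons i l ih => exact comm_mem_wordSpan_range h₁ h₂ i ih

end Normalizing

/-! ### Words times an idempotent. -/

section Idempotent

variable {x : ι → B} {e : B}

theorem shorterWordSpan_mul_mem {k : ℕ} {y : B} (hy : y ∈ shorterWordSpan x e k) (b : B) :
    y * b ∈ shorterWordSpan x e k := by
  refine AddSubgroup.map_mem_of_closure (AddMonoidHom.mulRight b) _ ?_ hy
  rintro _ ⟨l, hl, b', rfl⟩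
  exact AddSubgroup.subset_closure ⟨l, hl, b' * b, by simp [mul_assoc]⟩

theorem mul_shorterWordSpan_mem {k : ℕ} {y : B} (hy : y ∈ shorterWordSpan x e k) (i : ι) :
    x i * y ∈ shorterWordSpan x e (k + 1) := by
  refine AddSubgroup.map_mem_of_closure (AddMonoidHom.mulLeft (x i)) _ ?_ hy
  rintro _ ⟨l, hl, b, rfl⟩
  exact AddSubgroup.subset_closure ⟨i :: l, by simpa, b, by simp [mul_assoc]⟩

theorem shorterWordSpan_mono {k m : ℕ} (h : k ≤ m) :
    shorterWordSpan x e k ≤ shorterWordSpan x e m :=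
  AddSubgroup.closure_mono fun _ ⟨l, hl, h'⟩ => ⟨l, hl.trans_le h, h'⟩

/-- On expanding the commutator, only one term has all letters to the left of `e`; every other term
has moved at least one letter to the right. -/
theorem iteratedComm_sub_word_mul_mem (x : ι → B) (e : B) (l : List ι) :
    iteratedComm x l e - (l.map x).prod * e ∈ shorterWordSpan x e l.length := by
  induction l with
  | nil => simp [iteratedComm]
  | cons i l ih =>
    have h : iteratedComm x (i :: l) e - ((i :: l).map x).prod * e =
        x i * (iteratedComm x l e - (l.map x).prod * e) -
          ((iteratedComm x l e - (l.map x).prod * e) * x i + (l.map x).prod * e * x i) := by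
      simp only [iteratedComm, List.foldr_cons, List.map_cons, List.prod_cons]
      noncomm_ring
    rw [h]
    refine sub_mem (mul_shorterWordSpan_mem ih i) (add_mem
      (shorterWordSpan_mono (Nat.le_succ _) (shorterWordSpan_mul_mem ih _))
      (AddSubgroup.subset_closure ⟨l, by simp, x i, rfl⟩))

/-- For an idempotent `e`, words times `e` lie in the right ideal generated by the elements
`D e * e` with `D` an iterated commutator of at most the same length. -/
theorem word_mul_mem_closure_iteratedComm (he : IsIdempotentElem e) {n : ℕ} (l : List ι)
    (hl : l.length ≤ n) :
    (l.map x).prod * e ∈ AddSubgroup.closure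
      {y | ∃ u : List ι, u.length ≤ n ∧ ∃ b, y = iteratedComm x u e * e * b} := by
  induction hk : l.length using Nat.strong_induction_on generalizing l with
  | _ k ih =>
  set F := AddSubgroup.closure
      {y | ∃ u : List ι, u.length ≤ n ∧ ∃ b, y = iteratedComm x u e * e * b}
  -- Idempotence restores the right factor `e`. The error consists of terms `w' * e * b * e` with
  -- `w'` shorter, to which induction applies.
  have h : (l.map x).prod * e = iteratedComm x l e * e * 1 -
      (iteratedComm x l e - (l.map x).prod * e) * e := by
    rw [sub_mul, mul_assoc _ e e, he.eq]; noncomm_ring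
  rw [h]
  refine sub_mem (AddSubgroup.subset_closure ⟨l, hl, 1, rfl⟩) ?_
  refine AddSubgroup.map_mem_of_closure (AddMonoidHom.mulRight e) F ?_
    (iteratedComm_sub_word_mul_mem x e l)
  rintro _ ⟨l', hl', b, rfl⟩
  rw [AddMonoidHom.mulRight_apply, mul_assoc]
  refine AddSubgroup.map_mem_of_closure (AddMonoidHom.mulRight (b * e)) F ?_
    (ih _ (hk ▸ hl') l' (by omega) rfl)
  rintro _ ⟨u, hu, b', rfl⟩
  exact AddSubgroup.subset_closure ⟨u, hu, b' * (b * e), by simp [mul_assoc]⟩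

end Idempotent

/-- If `R` is locally nilpotent and the elements `x i` normalize its image in a ring, with
commutators in `ℤ + R`, then the subring of polynomials in the `x i` with coefficients in `R` has no
nonzero idempotent. -/
theorem IsLocallyNilpotentRing.eq_zero_of_isIdempotentElem {R : Type*} [NonUnitalRing R]
    (hR : IsLocallyNilpotentRing R) [Finite ι] (ρ : R →ₙ+* B) (x : ι → B)
    (h₁ : ∀ i r, ∃ r', x i * ρ r - ρ r * x i = ρ r')
    (h₂ : ∀ i j, ∃ (m : ℤ) (r : R), x i * x j - x j * x i = m + ρ r) {e : B}
    (he : IsIdempotentElem e)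
    (hmem : e ∈ AddSubgroup.closure
      {y | ∃ c ∈ Set.range ρ, ∃ l : List ι, y = c * (l.map x).prod}) :
    e = 0 := by
  classical
  obtain ⟨n, hn⟩ := exists_wordSpan_of_mem_closure hmem
  -- The degree bound `n` of `e` also bounds the commutators considered: as `ι` is finite there are
  -- finitely many words of length at most `n`, so the union `C` is finite.
  choose C' hC' using fun l => exists_finset_wordSpan ρ
    (iteratedComm_mem_wordSpan_range h₁ h₂ hn l)
  let C : Finset R := (List.finite_length_le ι n).toFinset.biUnion C'
  have hC : ∀ l : List ι, l.length ≤ n → iteratedComm x l e ∈ wordSpan x (ρ '' C) n :=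
    fun l hl => wordSpan_mono (Set.image_mono (by
      exact_mod_cast Finset.subset_biUnion_of_mem C' (by simpa using hl))) le_rfl (hC' l)
  obtain ⟨N, hN⟩ := hR C
  let K := NonUnitalSubring.closure (C : Set R)
  have hK : ∀ c ∈ C, c ∈ K := fun c hc => NonUnitalSubring.subset_closure hc
  -- The bound `n` is the same before and after the rewriting, so this step can be repeated.
  have step : ∀ l : List ι, l.length ≤ n → (l.map x).prod * e ∈ AddSubgroup.closure
      {y | ∃ c ∈ C, ∃ l : List ι, l.length ≤ n ∧ ∃ b, y = ρ c * (l.map x).prod * e * b} := by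
    intro l hl
    refine AddSubgroup.map_mem_of_closure (AddMonoidHom.id B) _ ?_
      (word_mul_mem_closure_iteratedComm he l hl)
    rintro _ ⟨u, hu, b, rfl⟩
    rw [AddMonoidHom.id_apply, mul_assoc]
    refine AddSubgroup.map_mem_of_closure (AddMonoidHom.mulRight (e * b)) _ ?_ (hC u hu)
    rintro _ ⟨_, ⟨c, hc, rfl⟩, l', hl', rfl⟩
    exact AddSubgroup.subset_closure ⟨c, hc, l', hl', b, by simp [mul_assoc]⟩
  -- After `M + 1` rewritings the coefficient is a product of `M + 1` factors: `a` and the `M`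
  -- entries of `s`. Each new factor arises to the right of the earlier ones, hence is appended to
  -- `s`.
  have key : ∀ M : ℕ, ∀ l : List ι, l.length ≤ n → (l.map x).prod * e ∈ AddSubgroup.closure
      {y | ∃ (a : K) (s : List K), s.length = M ∧ ∃ l : List ι, l.length ≤ n ∧
        ∃ b, y = ρ (s.foldl (fun x y => x * y) a : K) * (l.map x).prod * e * b} := by
    intro M
    induction M with
    | zero =>
      intro l hl
      refine AddSubgroup.closure_mono ?_ (step l hl)
      rintro _ ⟨c, hc, l', hl', b, rfl⟩
      exact ⟨⟨c, hK c hc⟩, [], rfl, l', hl', b, rfl⟩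
    | succ M ih =>
      intro l hl
      refine AddSubgroup.map_mem_of_closure (AddMonoidHom.id B) _ ?_ (ih l hl)
      rintro _ ⟨a, s, hs, l', hl', b, rfl⟩
      rw [AddMonoidHom.id_apply]
      generalize hz : ρ (s.foldl (fun x y => x * y) a : K) = z
      have hzb : z * (l'.map x).prod * e * b =
          (AddMonoidHom.mulLeft z).comp (AddMonoidHom.mulRight b) ((l'.map x).prod * e) := by
        simp [mul_assoc]
      rw [hzb]
      refine AddSubgroup.map_mem_of_closure _ _ ?_ (step l' hl')
      rintro _ ⟨c, hc, l'', hl'', b', rfl⟩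
      refine AddSubgroup.subset_closure
        ⟨a, s ++ [⟨c, hK c hc⟩], by simp [hs], l'', hl'', b' * b, ?_⟩
      simp [List.foldl_append, ← hz, mul_assoc]
  have hzero := key N [] (Nat.zero_le _)
  rw [show (([] : List ι).map x).prod * e = e by simp] at hzero
  rw [← AddSubgroup.mem_bot]
  refine (AddSubgroup.closure_le _).2 ?_ hzero
  rintro _ ⟨a, s, hs, l, _, b, rfl⟩
  have h := congrArg Subtype.val (hN a s hs)
  rw [SetLike.mem_coe, AddSubgroup.mem_bot]
  exact (congrArg (fun z => ρ z * (l.map x).prod * e * b) h).trans (by simp)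

end Words

/-! ### Passing to a quotient of a ring with identity. -/

/-- A criterion for an ideal `S` of a ring `T` with identity to be Behrens radical. -/
theorem IsBehrensRadical.of_forall_quotient {S T : Type u} [NonUnitalRing S] [Ring T]
    (φ : S →ₙ+* T) (hφ : Function.Injective φ) (hl : ∀ t s, ∃ s', t * φ s = φ s')
    (hr : ∀ s t, ∃ s', φ s * t = φ s')
    (h : ∀ (B : Type u) [Ring B] (g : T →+* B) (s : S), IsIdempotentElem (g (φ s)) →
      g (φ s) = 0) : IsBehrensRadical S := by
  intro B _ f hf e he
  obtain ⟨p, rfl⟩ := hf e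
  have hex : ∀ a t b, ∃ c, φ a * t * φ b = φ c := fun a t b => hl _ _
  -- The kernel of `f` need not be an ideal of `T`. Multiplying by the ideal `S` on both sides
  -- before applying `f` does define one.
  let J : TwoSidedIdeal T := TwoSidedIdeal.mk'
    {t | ∀ a b c, φ a * t * φ b = φ c → f c = 0}
    (by
      intro a b c hc
      rw [mul_zero, zero_mul, ← map_zero φ] at hc
      rw [← hφ hc, map_zero])
    (by
      intro t t' ht ht' a b c hc
      obtain ⟨c₁, h₁⟩ := hex a t b
      obtain ⟨c₂, h₂⟩ := hex a t' b
      rw [mul_add, add_mul, h₁, h₂, ← map_add] at hc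
      rw [← hφ hc, map_add, ht a b c₁ h₁, ht' a b c₂ h₂, add_zero])
    (by
      intro t ht a b c hc
      refine neg_eq_zero.1 ?_
      rw [← map_neg]
      refine ht a b _ ?_
      rw [map_neg, ← hc]
      noncomm_ring)
    (by
      intro t t' ht a b c hc
      obtain ⟨a', ha'⟩ := hr a t
      exact ht a' b c (by rw [← ha', ← hc]; noncomm_ring))
    (by
      intro t t' ht a b c hc
      obtain ⟨b', hb'⟩ := hl t' b
      exact ht a b' c (by rw [← hb', ← hc]; noncomm_ring))
  have hJ : ∀ t, t ∈ J ↔ ∀ a b c, φ a * t * φ b = φ c → f c = 0 := fun t =>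
    TwoSidedIdeal.mem_mk' ..
  have hquot := h J.ringCon.Quotient J.ringCon.mk' p (by
    rw [IsIdempotentElem, ← map_mul]
    refine (RingCon.eq _).2 ?_
    rw [← map_mul, TwoSidedIdeal.rel_iff, hJ]
    intro a b c hc
    rw [← map_sub, ← map_mul, ← map_mul] at hc
    rw [← hφ hc, map_mul, map_mul, map_sub, map_mul, he.eq, sub_self, mul_zero, zero_mul])
  have hmem : φ p ∈ J := by
    rw [← map_zero J.ringCon.mk'] at hquot
    have := (RingCon.eq _).1 hquot
    rwa [TwoSidedIdeal.rel_iff, sub_zero] at this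
  -- Testing `φ p ∈ J` against `p` on both sides gives `f (p * p * p) = 0`, and this value is `e`.
  have := (hJ _).1 hmem p p (p * p * p) (by simp)
  rwa [map_mul, map_mul, he.eq, he.eq] at this

/-! ### Differential polynomial rings: identity element and change of coefficients. -/

namespace DiffPoly

noncomputable section

section Identity

variable {A : Type u} [NonUnitalRing A] {d : RingDerivation A}

theorem monomial_zero_mul_monomial (a : A) (k : ℕ) (b : A) :
    monomial d 0 a * monomial d k b = monomial d k (a * b) := by
  rw [monomial_mul]
  exact mulConst_monomial a k b

variable {u : A}

/-- The identity is treated as an element `u` with explicit laws, so that these results can be used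
to build the ring structure on iterated extensions by recursion. -/
theorem derivation_identity (hl : ∀ a, u * a = a) (hr : ∀ a, a * u = a) : d u = 0 := by
  have h : d (u * u) = d u * u + u * d u := d.leibniz u u
  rw [hl, hl, hr] at h
  simpa using h

theorem mulConst_identity (hl : ∀ a, u * a = a) (p : DiffPoly d) : mulConst d u p = p := by
  refine DFunLike.congr_fun (f := mulConst d u) (g := AddMonoidHom.id _)
    (addHom_ext fun k a => ?_) p
  rw [mulConst_monomial, hl, AddMonoidHom.id_apply]

theorem identity_mul (hl : ∀ a, u * a = a) (p : DiffPoly d) : monomial d 0 u * p = p := by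
  rw [monomial_mul]
  exact mulConst_identity hl p

theorem mulX_monomial_identity (hl : ∀ a, u * a = a) (hr : ∀ a, a * u = a) (k : ℕ) :
    mulX d (monomial d k u) = monomial d (k + 1) u := by
  rw [mulX_monomial, derivation_identity hl hr, map_zero, add_zero]

theorem mul_identity (hl : ∀ a, u * a = a) (hr : ∀ a, a * u = a) (p : DiffPoly d) :
    p * monomial d 0 u = p := by
  have h : ∀ k, mulXPow d k (monomial d 0 u) = monomial d k u := by
    intro k
    induction k with
    | zero => rfl
    | succ k ih =>
      rw [mulXPow, AddMonoidHom.comp_apply, ih, mulX_monomial_identity hl hr]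
  refine DFunLike.congr_fun (f := AddMonoidHom.mulRight (monomial d 0 u))
    (g := AddMonoidHom.id _) (addHom_ext fun k a => ?_) p
  rw [AddMonoidHom.mulRight_apply, monomial_mul, h, mulConst_monomial, hr, AddMonoidHom.id_apply]

theorem monomial_one_mul (hl : ∀ a, u * a = a) (p : DiffPoly d) :
    monomial d 1 u * p = mulX d p := by
  rw [monomial_mul]
  exact mulConst_identity hl _

theorem monomial_one_mul_monomial_zero (hl : ∀ a, u * a = a) (hr : ∀ a, a * u = a) (a : A) :
    monomial d 1 u * monomial d 0 a =
      monomial d 0 a * monomial d 1 u + monomial d 0 (d a) := by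
  rw [monomial_one_mul hl, mulX_monomial, monomial_zero_mul_monomial, hr]

end Identity

theorem addHom_mem_of_monomial {A : Type u} [NonUnitalRing A] {d : RingDerivation A}
    {N : Type*} [AddGroup N] (f : DiffPoly d →+ N) (H : AddSubgroup N)
    (h : ∀ k a, f (monomial d k a) ∈ H) (p : DiffPoly d) : f p ∈ H :=
  Finsupp.induction_linear (motive := fun p : ℕ →₀ A => f p ∈ H) p
    ((map_zero f).symm ▸ zero_mem H)
    (fun p q hp hq => (map_add f p q).symm ▸ add_mem hp hq) h

section Map

variable {A A' : Type u} [NonUnitalRing A] [NonUnitalRing A'] {d : RingDerivation A}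
  {d' : RingDerivation A'}

/-- The map of differential polynomial rings given by a map of the coefficients. -/
def map (d : RingDerivation A) (d' : RingDerivation A') (φ : A →+ A') :
    DiffPoly d →+ DiffPoly d' :=
  Finsupp.liftAddHom fun k => (monomial d' k).comp φ

theorem map_monomial (φ : A →+ A') (k : ℕ) (a : A) :
    map d d' φ (monomial d k a) = monomial d' k (φ a) :=
  Finsupp.liftAddHom_apply_single _ _ _

theorem map_injective {φ : A →+ A'} (hφ : Function.Injective φ) :
    Function.Injective (map d d' φ) := by
  have h : map d d' φ = Finsupp.mapRange.addMonoidHom φ :=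
    addHom_ext fun k a => (map_monomial φ k a).trans
      (Finsupp.mapRange_single (hf := map_zero φ)).symm
  rw [h]
  exact Finsupp.mapRange_injective φ (map_zero φ) hφ

theorem map_mulConst {φ : A →+ A'} (hφ : ∀ a b, φ (a * b) = φ a * φ b) (a : A)
    (p : DiffPoly d) : map d d' φ (mulConst d a p) = mulConst d' (φ a) (map d d' φ p) := by
  refine DFunLike.congr_fun (f := (map d d' φ).comp (mulConst d a))
    (g := (mulConst d' (φ a)).comp (map d d' φ)) (addHom_ext fun k b => ?_) p
  simp [mulConst_monomial, map_monomial, hφ]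

theorem map_mulX {φ : A →+ A'} (hd : ∀ a, d' (φ a) = φ (d a)) (p : DiffPoly d) :
    map d d' φ (mulX d p) = mulX d' (map d d' φ p) := by
  refine DFunLike.congr_fun (f := (map d d' φ).comp (mulX d))
    (g := (mulX d').comp (map d d' φ)) (addHom_ext fun k b => ?_) p
  simp [mulX_monomial, map_monomial, hd]

theorem map_mulXPow {φ : A →+ A'} (hd : ∀ a, d' (φ a) = φ (d a)) (k : ℕ) (p : DiffPoly d) :
    map d d' φ (mulXPow d k p) = mulXPow d' k (map d d' φ p) := by
  induction k with
  | zero => rfl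
  | succ k ih => simp [mulXPow, map_mulX hd, ih]

theorem map_mul {φ : A →+ A'} (hφ : ∀ a b, φ (a * b) = φ a * φ b)
    (hd : ∀ a, d' (φ a) = φ (d a)) (p q : DiffPoly d) :
    map d d' φ (p * q) = map d d' φ p * map d d' φ q := by
  refine DFunLike.congr_fun (f := (map d d' φ).comp (AddMonoidHom.mulRight q))
    (g := (AddMonoidHom.mulRight (map d d' φ q)).comp (map d d' φ))
    (addHom_ext fun k b => ?_) p
  simp [monomial_mul, map_monomial, map_mulConst hφ, map_mulXPow hd]

/-- Left multiplication by `X` differentiates coefficients, so here `d'` must restrict to `d`; the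
right-hand version needs no such compatibility. -/
theorem mul_map_mem_range {φ : A →+ A'} (hd : ∀ a, d' (φ a) = φ (d a))
    (hl : ∀ t s, ∃ s', t * φ s = φ s') (q : DiffPoly d') (p : DiffPoly d) :
    ∃ p', q * map d d' φ p = map d d' φ p' := by
  have hconst : ∀ a p, mulConst d' a (map d d' φ p) ∈ (map d d' φ).range := by
    intro a p
    refine addHom_mem_of_monomial ((mulConst d' a).comp (map d d' φ)) _ (fun k b => ?_) _
    obtain ⟨s, hs⟩ := hl a b
    refine ⟨monomial d k s, ?_⟩
    rw [map_monomial, ← hs, ← mulConst_monomial, ← map_monomial (d := d)]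
    rfl
  have : q * map d d' φ p ∈ (map d d' φ).range := by
    refine addHom_mem_of_monomial (AddMonoidHom.mulRight (map d d' φ p)) _
      (fun k a => ?_) _
    change monomial d' k a * _ ∈ _
    rw [monomial_mul, ← map_mulXPow hd]
    exact hconst _ _
  obtain ⟨p', h⟩ := this
  exact ⟨p', h.symm⟩

theorem map_mul_mem_range {φ : A →+ A'} (hr : ∀ s t, ∃ s', φ s * t = φ s') (p : DiffPoly d)
    (q : DiffPoly d') : ∃ p', map d d' φ p * q = map d d' φ p' := by
  have hconst : ∀ a q, mulConst d' (φ a) q ∈ (map d d' φ).range := by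
    intro a q
    refine addHom_mem_of_monomial (mulConst d' (φ a)) _ (fun k b => ?_) _
    obtain ⟨s, hs⟩ := hr a b
    refine ⟨monomial d k s, ?_⟩
    rw [map_monomial, ← hs, ← mulConst_monomial]
  have : map d d' φ p * q ∈ (map d d' φ).range := by
    refine addHom_mem_of_monomial ((AddMonoidHom.mulRight q).comp (map d d' φ)) _
      (fun k a => ?_) _
    change map d d' φ (monomial d k a) * q ∈ _
    rw [map_monomial, monomial_mul]
    exact hconst _ _
  obtain ⟨p', h⟩ := this
  exact ⟨p', h.symm⟩

end Map

end

end DiffPoly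

/-! ### Iterated extensions: commutation relations and the embedding over `R*`. -/

namespace DerivationSeq

noncomputable section

section Identity

variable {K : Type u} [Ring K]

theorem const_one_mul_and_mul_const_one : ∀ {n : ℕ} (d : DerivationSeq K n),
    (∀ p : IteratedDiffPoly d, d.const 1 * p = p) ∧ ∀ p : IteratedDiffPoly d, p * d.const 1 = p
  | 0, _ => ⟨fun p => one_mul (M := K) p, fun p => mul_one (M := K) p⟩
  | _ + 1, d =>
    have h := const_one_mul_and_mul_const_one d.init
    ⟨DiffPoly.identity_mul (d := d.last) h.1, DiffPoly.mul_identity (d := d.last) h.1 h.2⟩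

instance {n : ℕ} (d : DerivationSeq K n) : Ring (IteratedDiffPoly d) :=
  { (inferInstance : NonUnitalRing (IteratedDiffPoly d)) with
    one := d.const 1
    one_mul := (const_one_mul_and_mul_const_one d).1
    mul_one := (const_one_mul_and_mul_const_one d).2 }

theorem const_one {n : ℕ} (d : DerivationSeq K n) : d.const 1 = 1 := rfl

/-- The inclusion of `R[X₁;d₁]⋯[Xₙ;dₙ]` in `R[X₁;d₁]⋯[Xₙ₊₁;dₙ₊₁]`. -/
def constHom {n : ℕ} (d : DerivationSeq K (n + 1)) :
    IteratedDiffPoly d.init →+* IteratedDiffPoly d where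
  __ := d.monomial 0
  map_one' := rfl
  map_mul' a b := (DiffPoly.monomial_zero_mul_monomial (d := d.last) a 0 b).symm

/-- The last variable. -/
def lastVar {n : ℕ} (d : DerivationSeq K (n + 1)) : IteratedDiffPoly d := d.monomial 1 1

theorem var_last {n : ℕ} (d : DerivationSeq K (n + 1)) : d.var (Fin.last n) = d.lastVar := by
  simp [var, lastVar, const_one]

theorem var_castSucc {n : ℕ} (d : DerivationSeq K (n + 1)) (j : Fin n) :
    d.var j.castSucc = d.constHom (d.init.var j) := by
  simp [var, constHom]

theorem const_succ {n : ℕ} (d : DerivationSeq K (n + 1)) (r : K) :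
    d.const r = d.constHom (d.init.const r) := rfl

theorem lastVar_mul_constHom {n : ℕ} (d : DerivationSeq K (n + 1)) (a : IteratedDiffPoly d.init) :
    d.lastVar * d.constHom a = d.constHom a * d.lastVar + d.constHom (d.last a) :=
  DiffPoly.monomial_one_mul_monomial_zero (d := d.last) (one_mul (M := IteratedDiffPoly d.init))
    (mul_one (M := IteratedDiffPoly d.init)) a

theorem monomial_eq_constHom_mul_lastVar_pow {n : ℕ} (d : DerivationSeq K (n + 1)) (k : ℕ)
    (a : IteratedDiffPoly d.init) : d.monomial k a = d.constHom a * d.lastVar ^ k := by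
  have h : ∀ k, d.lastVar ^ k = d.monomial k 1 := by
    intro k
    induction k with
    | zero => rfl
    | succ k ih =>
      rw [pow_succ', ih]
      exact (DiffPoly.monomial_one_mul (d := d.last) (one_mul (M := IteratedDiffPoly d.init)) _).trans
        (DiffPoly.mulX_monomial_identity (d := d.last) (one_mul (M := IteratedDiffPoly d.init))
        (mul_one (M := IteratedDiffPoly d.init)) k)
  rw [h]
  refine ((DiffPoly.monomial_zero_mul_monomial (d := d.last) a k _).trans ?_).symm
  rw [mul_one (M := IteratedDiffPoly d.init)]
  rfl

theorem const_mul {n : ℕ} (d : DerivationSeq K n) (r s : K) :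
    d.const (r * s) = d.const r * d.const s := by
  induction n with
  | zero => rfl
  | succ n ih => rw [const_succ, ih, map_mul]; rfl

end Identity

variable {R : Type u} [NonUnitalRing R]

/-- The inclusion of `R` in `R*[X₁;d₁]⋯[Xₙ;dₙ]`. -/
def baseHom {n : ℕ} (D : DerivationSeq (Unitization ℤ R) n) : R →ₙ+* IteratedDiffPoly D where
  toFun r := D.const (r : Unitization ℤ R)
  map_zero' := by rw [Unitization.inr_zero, map_zero]
  map_add' r s := by rw [Unitization.inr_add, map_add]
  map_mul' r s := by rw [Unitization.inr_mul, const_mul]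

theorem baseHom_succ {n : ℕ} (D : DerivationSeq (Unitization ℤ R) (n + 1)) (r : R) :
    D.baseHom r = D.constHom (D.init.baseHom r) := rfl

theorem const_eq_intCast_add {n : ℕ} (D : DerivationSeq (Unitization ℤ R) n)
    (s : Unitization ℤ R) : D.const s = s.fst + D.baseHom s.snd := by
  have h : s = s.fst • (1 : Unitization ℤ R) + (s.snd : Unitization ℤ R) := by
    refine Unitization.ext ?_ ?_
    · change s.fst = s.fst • (1 : ℤ) + 0
      simp
    · change s.snd = s.fst • (0 : R) + s.snd
      simp
  conv_lhs => rw [h]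
  rw [map_add, map_zsmul, const_one, zsmul_one]
  rfl

/-- For the last variable the commutator with a constant is the last derivation applied to it;
earlier variables are handled in the smaller ring. -/
theorem comm_var_baseHom {n : ℕ} {D : DerivationSeq (Unitization ℤ R) n} (hD : D.PreservesBase)
    (i : Fin n) (r : R) : ∃ r', D.var i * D.baseHom r - D.baseHom r * D.var i = D.baseHom r' := by
  induction n with
  | zero => exact i.elim0
  | succ n ih =>
    induction i using Fin.lastCases with
    | last =>
      obtain ⟨r', h⟩ := hD.2 r
      refine ⟨r', ?_⟩
      rw [var_last, baseHom_succ, lastVar_mul_constHom, add_sub_cancel_left, baseHom_succ]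
      exact congrArg D.constHom h
    | cast i =>
      obtain ⟨r', h⟩ := ih hD.1 i
      refine ⟨r', ?_⟩
      rw [var_castSucc, baseHom_succ, baseHom_succ, ← h, map_sub, map_mul, map_mul]

theorem comm_var_var {n : ℕ} {D : DerivationSeq (Unitization ℤ R) n} (hD : D.MapsVarsToConst)
    (i j : Fin n) :
    ∃ (m : ℤ) (r : R), D.var i * D.var j - D.var j * D.var i = m + D.baseHom r := by
  induction n with
  | zero => exact i.elim0
  | succ n ih =>
    have hlast : ∀ j : Fin n, ∃ (m : ℤ) (r : R),
        D.lastVar * D.var j.castSucc - D.var j.castSucc * D.lastVar = m + D.baseHom r := by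
      intro j
      obtain ⟨s, h⟩ := hD.2 j
      refine ⟨s.fst, s.snd, ?_⟩
      rw [var_castSucc, lastVar_mul_constHom, add_sub_cancel_left, ← const_eq_intCast_add]
      exact congrArg D.constHom h
    induction i using Fin.lastCases with
    | last =>
      induction j using Fin.lastCases with
      | last => exact ⟨0, 0, by simp⟩
      | cast j => simpa only [var_last] using hlast j
    | cast i =>
      induction j using Fin.lastCases with
      | last =>
        obtain ⟨m, r, h⟩ := hlast i
        refine ⟨-m, -r, ?_⟩
        rw [var_last, ← neg_sub, h]
        simp [add_comm]
      | cast j =>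
        obtain ⟨m, r, h⟩ := ih hD.1 i j
        refine ⟨m, r, ?_⟩
        rw [var_castSucc, var_castSucc, baseHom_succ, ← map_intCast D.constHom, ← map_add, ← h,
          map_sub, map_mul, map_mul]

theorem incl_injective : ∀ {n : ℕ} (d : DerivationSeq R n)
    (D : DerivationSeq (Unitization ℤ R) n), Function.Injective (incl d D)
  | 0, _, _ => Unitization.inr_injective
  | _ + 1, d, D => DiffPoly.map_injective (A := IteratedDiffPoly d.init)
      (A' := IteratedDiffPoly D.init) (d := d.last) (d' := D.last) (incl_injective d.init D.init)

theorem incl_mul : ∀ {n : ℕ} {d : DerivationSeq R n} {D : DerivationSeq (Unitization ℤ R) n},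
    D.Extends d → ∀ p q, incl d D (p * q) = incl d D p * incl d D q
  | 0, _, _, _ => Unitization.inr_mul ℤ
  | _ + 1, d, D, h => DiffPoly.map_mul (A := IteratedDiffPoly d.init)
      (A' := IteratedDiffPoly D.init) (d := d.last) (d' := D.last) (incl_mul h.1) h.2

theorem mul_incl_mem_range : ∀ {n : ℕ} {d : DerivationSeq R n}
    {D : DerivationSeq (Unitization ℤ R) n}, D.Extends d → ∀ t p, ∃ p', t * incl d D p = incl d D p'
  | 0, _, _, _, (t : Unitization ℤ R), (p : R) =>
    ⟨(t.fst • p + t.snd * p : R), by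
      change t * (p : Unitization ℤ R) = ((t.fst • p + t.snd * p : R) : Unitization ℤ R)
      ext <;> simp [-zsmul_eq_mul]⟩
  | _ + 1, d, D, h, t, p => DiffPoly.mul_map_mem_range (A := IteratedDiffPoly d.init)
      (A' := IteratedDiffPoly D.init) (d := d.last) (d' := D.last) h.2
      (mul_incl_mem_range h.1) t p

theorem incl_mul_mem_range : ∀ {n : ℕ} (d : DerivationSeq R n)
    (D : DerivationSeq (Unitization ℤ R) n), ∀ p t, ∃ p', incl d D p * t = incl d D p'
  | 0, _, _, (p : R), (t : Unitization ℤ R) =>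
    ⟨(t.fst • p + p * t.snd : R), by
      change (p : Unitization ℤ R) * t = ((t.fst • p + p * t.snd : R) : Unitization ℤ R)
      ext <;> simp [-zsmul_eq_mul]⟩
  | _ + 1, d, D, p, t => DiffPoly.map_mul_mem_range (incl_mul_mem_range d.init D.init) p t

theorem incl_mem_closure {n : ℕ} (d : DerivationSeq R n) (D : DerivationSeq (Unitization ℤ R) n)
    (p : IteratedDiffPoly d) : incl d D p ∈ AddSubgroup.closure
      {y | ∃ c ∈ Set.range D.baseHom, ∃ l : List (Fin n), y = c * (l.map D.var).prod} := by
  induction n with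
  | zero =>
    refine AddSubgroup.subset_closure ⟨_, ⟨p, rfl⟩, [], ?_⟩
    rw [List.map_nil, List.prod_nil, mul_one]
    rfl
  | succ n ih =>
    refine DiffPoly.addHom_mem_of_monomial (d := d.last) (incl d D) _
      (fun k a => ?_) _
    have h : incl d D (d.monomial k a) = D.monomial k (incl d.init D.init a) :=
      DiffPoly.map_monomial (A := IteratedDiffPoly d.init) (A' := IteratedDiffPoly D.init)
        (d := d.last) (d' := D.last) _ k a
    refine Eq.mp (congrArg (· ∈ _) h.symm) ?_
    rw [monomial_eq_constHom_mul_lastVar_pow]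
    refine AddSubgroup.map_mem_of_closure ((AddMonoidHom.mulRight (D.lastVar ^ k)).comp
      D.constHom.toAddMonoidHom) _ ?_ (ih d.init D.init a)
    rintro _ ⟨_, ⟨r, rfl⟩, l, rfl⟩
    refine AddSubgroup.subset_closure
      -- A term `r * w` of the coefficient of `Xᵏ` becomes `r` times the word `w` followed by `k`
      -- copies of the last variable.
      ⟨_, ⟨r, rfl⟩, l.map Fin.castSucc ++ List.replicate k (Fin.last n), ?_⟩
    have hvar : D.var ∘ Fin.castSucc = D.constHom ∘ D.init.var := funext D.var_castSucc
    simp [hvar, var_last, map_list_prod, baseHom_succ, mul_assoc]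

end

end DerivationSeq

/-! ### The theorem. -/

theorem theorem4 {R : Type u} [NonUnitalRing R] (hR : IsLocallyNilpotentRing R)
    (n : ℕ) (d : DerivationSeq R n)
    (hd : ∃ D : DerivationSeq (Unitization ℤ R) n,
      D.Extends d ∧ D.PreservesBase ∧ D.MapsVarsToConst) :
    IsBehrensRadical (IteratedDiffPoly d) := by
  obtain ⟨D, hext, hbase, hvars⟩ := hd
  let φ : IteratedDiffPoly d →ₙ+* IteratedDiffPoly D :=
    { DerivationSeq.incl d D with map_mul' := DerivationSeq.incl_mul hext }
  refine .of_forall_quotient φ (DerivationSeq.incl_injective d D)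
    (DerivationSeq.mul_incl_mem_range hext)
    (DerivationSeq.incl_mul_mem_range d D) fun B _ g s hs => ?_
  let ρ : R →ₙ+* B :=
    { toFun := fun r => g (D.baseHom r)
      map_zero' := by simp
      map_add' := by simp
      map_mul' := by simp }
  have hρ : ∀ r, ρ r = g (D.baseHom r) := fun _ => rfl
  refine hR.eq_zero_of_isIdempotentElem ρ
    (fun i => g (D.var i)) ?_ ?_ hs ?_
  · intro i r
    obtain ⟨r', h⟩ := DerivationSeq.comm_var_baseHom hbase i r
    exact ⟨r', by simp [hρ, ← h]⟩
  · intro i j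
    obtain ⟨m, r, h⟩ := DerivationSeq.comm_var_var hvars i j
    exact ⟨m, r, by simpa [hρ] using congrArg g h⟩
  · refine AddSubgroup.map_mem_of_closure g.toAddMonoidHom _ ?_
      (DerivationSeq.incl_mem_closure d D s)
    rintro _ ⟨_, ⟨r, rfl⟩, l, rfl⟩
    exact AddSubgroup.subset_closure ⟨_, ⟨r, rfl⟩, l,
      by simp [hρ, map_list_prod, Function.comp_def]⟩
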